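/- **Proposition 6.2.** Let $(Y,X^{(1)},\dots,X^{(p)})$ be a random vector with values in $\mathbb R^{p+1}$ whose entries are square integrable, with $\mathrm{Var}(Y)>0$ and $\mathrm{Var}(X^{(j)})>0$ for all $j\in\{1,\dots,p\}$, and let $(Y_i,X_i^{(1)},\dots,X_i^{(p)})_{i\ge 1}$ be independent copies of it. For $k\in\{1,\dots,p\}$ let $U^{(k)}$ be the subspace of $\mathbb L^2$ generated by $\mathbf 1$ and $X^{(k)}$, let $W$ be the subspace of $\mathbb L^2$ generated by $\mathbf 1$ and $Y$, and, with $\mathrm{Proj}$ denoting orthogonal projection in $\mathbb L^2$, let $$\varepsilon^{(k)}=Y-\mathrm{Proj}_{U^{(k)}}(Y),\qquad e^{(k)}=X^{(k)}-\mathrm{Proj}_W(X^{(k)}),\qquad R^2_{(k)}=\frac{\mathrm{Var}(\mathrm{Proj}_{U^{(k)}}(Y))}{\mathrm{Var}(Y)},$$ $$\theta_k=\frac{\mathrm{Cov}(Y,X^{(k)})}{\mathrm{Var}(Y)},\qquad \tau_k=\frac{\mathrm{Cov}(Y,X^{(k)})}{\mathrm{Var}(X^{(k)})}.$$ Write $\overline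 Y=\frac1n\sum_{i=1}^nY_i$ and $\overline X^{(k)}=\frac1n\sum_{i=1}^nX_i^{(k)}$. The empirical estimator of $R^2_{(k)}$ based on the first $n$ observations is $\widehat R^2_{(k)}=\widehat\tau_k\,\widehat\theta_k$, where $$\widehat\theta_k=\frac{\sum_{i=1}^n(Y_i-\overline Y)(X_i^{(k)}-\overline X^{(k)})}{\sum_{i=1}^n(Y_i-\overline Y)^2},\qquad \widehat\tau_k=\frac{\sum_{i=1}^n(Y_i-\overline Y)(X_i^{(k)}-\overline X^{(k)})}{\sum_{i=1}^n(X_i^{(k)}-\overline X^{(k)})^2}$$ (a quotient with denominator $0$ is read as $0$). Assume that for all $j\in\{1,\dots,p\}$ $$\mathbb E\big((X^{(j)}-\mathbb E X^{(j)})^2(\varepsilon^{(j)})^2\big)<\infty\quad\text{and}\quad \mathbb E\big((Y-\mathbb E Y)^2(e^{(j)})^2\big)<\infty.$$ Let $\mathbf C$ be the symmetric $2p\times 2p$ matrix given, for $j,k\in\{1,\dots,p\}$, by $$\mathbf C_{j,k}=\mathbb E\big((X^{(j)}-\mathbb EX^{(j)})(X^{(k)}-\mathbb EX^{(k)})\varepsilon^{(j)}\varepsilon^{(k)}\big),\qquad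 \mathbf C_{p+j,p+k}=\mathbb E\big((Y-\mathbb EY)^2e^{(j)}e^{(k)}\big),$$ $$\mathbf C_{j,p+k}=\mathbf C_{p+k,j}=\mathbb E\big((X^{(j)}-\mathbb EX^{(j)})(Y-\mathbb EY)\varepsilon^{(j)}e^{(k)}\big),$$ let $\mathbf D$ be the $2p\times 2p$ diagonal matrix with $\mathbf D_{j,j}=1/\mathrm{Var}(X^{(j)})$ and $\mathbf D_{p+j,p+j}=1/\mathrm{Var}(Y)$ for $1\le j\le p$, and let $\mathbf H$ be the $p\times 2p$ matrix with $\mathbf H_{i,j}=\theta_i\delta_{i,j}$ and $\mathbf H_{i,p+j}=\tau_i\delta_{i,j}$ for $i,j\in\{1,\dots,p\}$. Then $\mathbf H\mathbf D\mathbf C\mathbf D\mathbf H^t$ is symmetric positive semidefinite (hence a covariance matrix) and, as $n\to\infty$, $$\sqrt n\Big((\widehat R^2_{(1)},\dots,\widehat R^2_{(p)})^t-(R^2_{(1)},\dots,R^2_{(p)})^t\Big)\ \xrightarrow{\ \mathcal L\ }\ \mathcal N\big(0,\ \mathbf H\mathbf D\mathbf C\mathbf D\mathbf H^t\big).$$ 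-/

import Mathlib

open MeasureTheory ProbabilityTheory Filter

namespace IndividualR2

noncomputable section

section Population

variable {Ω : Type*} [MeasurableSpace Ω] {P : Measure Ω} [IsProbabilityMeasure P]

/-- The subspace of `L²(P)` generated by the constant variable `1` and the variable `Z`. -/
def spanOneAnd {Z : Ω → ℝ} (hZ : MemLp Z 2 P) : Submodule ℝ (Lp ℝ 2 P) :=
  Submodule.span ℝ {(memLp_const (1 : ℝ)).toLp (fun _ : Ω => (1 : ℝ)), hZ.toLp Z}

instance {Z : Ω → ℝ} (hZ : MemLp Z 2 P) : FiniteDimensional ℝ (spanOneAnd hZ) :=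
  FiniteDimensional.span_of_finite ℝ (Set.toFinite _)

/-- The orthogonal projection in `L²(P)` of `T` onto the subspace generated by `1` and `Z`. -/
def proj {Z T : Ω → ℝ} (hZ : MemLp Z 2 P) (hT : MemLp T 2 P) : Ω → ℝ :=
  ((spanOneAnd hZ).starProjection (hT.toLp T) : Lp ℝ 2 P)

/-- The residual of `T` after projection onto the subspace generated by `1` and `Z`. -/
def residual {Z T : Ω → ℝ} (hZ : MemLp Z 2 P) (hT : MemLp T 2 P) : Ω → ℝ :=
  fun ω => T ω - proj hZ hT ω

/-- The individual coefficient: the proportion of the variance of `Y` explained by the best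
linear predictor based on `1` and `Z`. -/
def rSq {Z Y : Ω → ℝ} (hZ : MemLp Z 2 P) (hY : MemLp Y 2 P) : ℝ :=
  Var[proj hZ hY; P] / Var[Y; P]

variable {p : ℕ}

/-- `θ_k = Cov(Y, X_k) / Var(Y)`. -/
def theta (P : Measure Ω) (Y : Ω → ℝ) (X : Fin p → Ω → ℝ) (k : Fin p) : ℝ :=
  cov[Y, X k; P] / Var[Y; P]

/-- `τ_k = Cov(Y, X_k) / Var(X_k)`. -/
def tau (P : Measure Ω) (Y : Ω → ℝ) (X : Fin p → Ω → ℝ) (k : Fin p) : ℝ :=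
  cov[Y, X k; P] / Var[X k; P]

/-- The symmetric `2p × 2p` matrix `C`. Its rows and columns are indexed by `Fin p ⊕ Fin p`:
the left summand stands for `1, …, p`, the right summand for `p + 1, …, 2p`. -/
def matC {Y : Ω → ℝ} {X : Fin p → Ω → ℝ} (hY : MemLp Y 2 P) (hX : ∀ k, MemLp (X k) 2 P) :
    Matrix (Fin p ⊕ Fin p) (Fin p ⊕ Fin p) ℝ :=
  let upperRight : Matrix (Fin p) (Fin p) ℝ := Matrix.of fun j k =>
    ∫ ω, (X j ω - ∫ ω', X j ω' ∂P) * (Y ω - ∫ ω', Y ω' ∂P) *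
      residual (hX j) hY ω * residual hY (hX k) ω ∂P
  Matrix.fromBlocks
    (Matrix.of fun j k =>
      ∫ ω, (X j ω - ∫ ω', X j ω' ∂P) * (X k ω - ∫ ω', X k ω' ∂P) *
        residual (hX j) hY ω * residual (hX k) hY ω ∂P)
    upperRight
    upperRight.transpose
    (Matrix.of fun j k =>
      ∫ ω, (Y ω - ∫ ω', Y ω' ∂P) ^ 2 *
        residual hY (hX j) ω * residual hY (hX k) ω ∂P)

/-- The `2p × 2p` diagonal matrix `D`, with diagonal
`(1 / Var(X_1), …, 1 / Var(X_p), 1 / Var(Y), …, 1 / Var(Y))`. -/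
def matD (P : Measure Ω) (Y : Ω → ℝ) (X : Fin p → Ω → ℝ) :
    Matrix (Fin p ⊕ Fin p) (Fin p ⊕ Fin p) ℝ :=
  Matrix.diagonal (Sum.elim (fun j => (Var[X j; P])⁻¹) (fun _ => (Var[Y; P])⁻¹))

/-- The `p × 2p` matrix `H = [diag(θ) | diag(τ)]`. -/
def matH (P : Measure Ω) (Y : Ω → ℝ) (X : Fin p → Ω → ℝ) :
    Matrix (Fin p) (Fin p ⊕ Fin p) ℝ :=
  Matrix.fromCols (Matrix.diagonal (theta P Y X)) (Matrix.diagonal (tau P Y X))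

/-- The limiting covariance matrix `H D C D Hᵗ`. -/
def asympCov {Y : Ω → ℝ} {X : Fin p → Ω → ℝ} (hY : MemLp Y 2 P) (hX : ∀ k, MemLp (X k) 2 P) :
    Matrix (Fin p) (Fin p) ℝ :=
  matH P Y X * matD P Y X * matC hY hX * matD P Y X * (matH P Y X).transpose

end Population

section Sample

/-- The empirical mean of the first `n` terms of `z`. -/
def sampleMean (n : ℕ) (z : ℕ → ℝ) : ℝ := (∑ i ∈ Finset.range n, z i) / n

/-- `∑_{i < n} (y_i - ȳ) (x_i - x̄)`. -/
def sampleCross (n : ℕ) (y x : ℕ → ℝ) : ℝ :=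
  ∑ i ∈ Finset.range n, (y i - sampleMean n y) * (x i - sampleMean n x)

/-- The empirical counterpart of `θ_k`, from observations `(y_i, x_i)`, `i < n`. -/
def thetaHat (n : ℕ) (y x : ℕ → ℝ) : ℝ := sampleCross n y x / sampleCross n y y

/-- The empirical counterpart of `τ_k`, from observations `(y_i, x_i)`, `i < n`. -/
def tauHat (n : ℕ) (y x : ℕ → ℝ) : ℝ := sampleCross n y x / sampleCross n x x

/-- The empirical estimator of the individual coefficient. -/
def rSqHat (n : ℕ) (y x : ℕ → ℝ) : ℝ := tauHat n y x * thetaHat n y x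

end Sample

end

end IndividualR2

/-! The projection of `Y` onto the span of `1` and `X k` is the regression line, so its variance is
the squared slope times the variance of `X k`, and the individual coefficient is the product τ_k
θ_k. The estimator is the matching product of empirical slopes, and τ̂θ̂ - τθ = θ̂(τ̂ - τ) + τ(θ̂ -
θ). Up to negligible terms, each slope error is an average of products "centred regressor times
residual", divided by the variance of the regressor. Hence √n(R̂² - R²) equals n^(-1/2) times a sum
of i.i.d. centred variables ψ_k (`influence`), up to a term tending to zero in probability
(`tendstoInMeasure_rSqHat_sub`).

The error terms are normalised sums, bounded in probability by Chebyshev, times factors that tend to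
zero almost surely by the law of large numbers (`tendstoInMeasure_inv_sqrt_mul_sum_mul`). Square
integrability of the entries and of these products therefore suffices.

The matrix H D C D Hᵗ is the Gram matrix in L² of the ψ_k (`asympCov_apply`). This gives positive
semidefiniteness at once and identifies the limit in the vector central limit theorem
(`tendstoInDistribution_multivariateGaussian`); Slutsky's theorem then concludes. -/

open scoped Topology

/-! ### Convergence in measure and the vector central limit theorem -/

/-- A sequence dominated by a finite sum of sequences converging to zero in measure converges
to zero in measure. -/
theorem tendstoInMeasure_zero_of_norm_le_sum {Ω E κ : Type*} [MeasurableSpace Ω] {P : Measure Ω}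
    [NormedAddCommGroup E] [Fintype κ] {f : ℕ → Ω → E} {g : κ → ℕ → Ω → ℝ}
    (hg : ∀ k, TendstoInMeasure P (g k) atTop 0)
    (hle : ∀ n ω, ‖f n ω‖ ≤ ∑ k, |g k n ω|) :
    TendstoInMeasure P f atTop 0 := by
  rw [tendstoInMeasure_iff_norm]
  intro ε hε
  -- The `+ 1` covers an empty `κ` and makes the sum of the thresholds strictly smaller than `ε`.
  set δ : ℝ := ε / (Fintype.card κ + 1) with hδ_def
  have hδ : 0 < δ := by positivity
  have hsum : Tendsto (fun n => ∑ k, P {ω | δ ≤ |g k n ω|}) atTop (𝓝 0) := by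
    rw [← Finset.sum_const_zero (ι := κ) (s := Finset.univ)]
    refine tendsto_finsetSum _ fun k _ => ?_
    simpa [Real.norm_eq_abs] using (tendstoInMeasure_iff_norm.1 (hg k)) δ hδ
  refine tendsto_of_tendsto_of_tendsto_of_le_of_le tendsto_const_nhds hsum
    (fun _ => zero_le) fun n => ?_
  refine (measure_mono ?_).trans (measure_iUnion_fintype_le P fun k => {ω | δ ≤ |g k n ω|})
  intro ω hω
  simp only [Set.mem_ofPred_eq, Pi.zero_apply, sub_zero] at hω
  by_contra hcon
  simp only [Set.mem_iUnion, Set.mem_ofPred_eq, not_exists, not_le] at hcon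
  have h1 : ∑ k, |g k n ω| ≤ ∑ _k : κ, δ := Finset.sum_le_sum fun k _ => (hcon k).le
  have h2 : ∑ _k : κ, δ < ε := by
    rw [Finset.sum_const, Finset.card_univ, nsmul_eq_mul, hδ_def, mul_div_assoc',
      div_lt_iff₀ (by positivity)]
    nlinarith
  linarith [hle n ω]

/-- The normalised sum of centred i.i.d. square integrable variables, multiplied by a sequence
that converges to zero almost everywhere, converges to zero in measure. -/
theorem tendstoInMeasure_inv_sqrt_mul_sum_mul {Ω : Type*} [MeasurableSpace Ω] {P : Measure Ω}
    [IsProbabilityMeasure P] {Z c : ℕ → Ω → ℝ} (hZ : MemLp (Z 0) 2 P) (hmean : ∫ ω, Z 0 ω ∂P = 0)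
    (hindep : iIndepFun Z P) (hident : ∀ i, IdentDistrib (Z i) (Z 0) P P)
    (hc : ∀ n, AEMeasurable (c n) P) (hc0 : ∀ᵐ ω ∂P, Tendsto (fun n => c n ω) atTop (𝓝 0)) :
    TendstoInMeasure P (fun (n : ℕ) ω => (√(n : ℝ))⁻¹ * (∑ i ∈ Finset.range n, Z i ω) * c n ω)
      atTop 0 := by
  have hcM : TendstoInMeasure P c atTop 0 :=
    tendstoInMeasure_of_tendsto_ae (fun n => (hc n).aestronglyMeasurable) hc0
  have hL : ∀ i, MemLp (Z i) 2 P := fun i => (hident i).memLp_iff.2 hZ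
  set v := Var[Z 0; P] with hv
  -- Tightness, uniformly in `n`: the normalised sum has variance at most `v`. Only an inequality
  -- holds in general, since at `n = 0` the inverse root is read as `0`.
  have hcheb : ∀ (n : ℕ) (M : ℝ), 0 < M →
      P {ω | M ≤ |(√(n : ℝ))⁻¹ * ∑ i ∈ Finset.range n, Z i ω|} ≤ ENNReal.ofReal (v / M ^ 2) := by
    intro n M hM
    have hS : MemLp (∑ i ∈ Finset.range n, Z i) 2 P := memLp_finsetSum' _ fun i _ => hL i
    have hQ : MemLp (fun ω => (√(n : ℝ))⁻¹ * (∑ i ∈ Finset.range n, Z i) ω) 2 P := hS.const_mul _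
    have h := meas_ge_le_variance_div_sq hQ hM
    have hE : ∫ ω, (√(n : ℝ))⁻¹ * (∑ i ∈ Finset.range n, Z i) ω ∂P = 0 := by
      rw [integral_const_mul]
      simp only [Finset.sum_apply]
      rw [integral_finsetSum _ fun i _ => (hL i).integrable (by norm_num)]
      simp [fun i => (hident i).integral_eq, hmean]
    rw [hE, variance_const_mul, IndepFun.variance_sum (fun i _ => hL i)
      fun i _ j _ hij => hindep.indepFun hij] at h
    simp only [fun i => (hident i).variance_eq, Finset.sum_const, Finset.card_range,
      nsmul_eq_mul, sub_zero, Finset.sum_apply] at h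
    refine h.trans (ENNReal.ofReal_le_ofReal ?_)
    gcongr
    rw [inv_pow, Real.sq_sqrt (Nat.cast_nonneg n), ← mul_assoc]
    exact mul_le_of_le_one_left (variance_nonneg _ _) inv_mul_le_one
  rw [tendstoInMeasure_iff_norm]
  intro ε hε
  rw [ENNReal.tendsto_nhds_zero]
  intro η hη
  obtain ⟨M, hM, hMη⟩ : ∃ M : ℝ, 0 < M ∧ ENNReal.ofReal (v / M ^ 2) ≤ η / 2 := by
    have h1 : Tendsto (fun M : ℝ => ENNReal.ofReal (v / M ^ 2)) atTop (𝓝 0) := by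
      have : Tendsto (fun M : ℝ => v / M ^ 2) atTop (𝓝 0) :=
        tendsto_const_nhds.div_atTop (tendsto_pow_atTop two_ne_zero)
      simpa [Function.comp_def] using (ENNReal.continuous_ofReal.tendsto 0).comp this
    obtain ⟨M, h, hM⟩ := ((ENNReal.tendsto_nhds_zero.1 h1 (η / 2)
      (ENNReal.half_pos hη.ne')).and (eventually_gt_atTop 0)).exists
    exact ⟨M, hM, h⟩
  have h2 := ENNReal.tendsto_nhds_zero.1 (tendstoInMeasure_iff_norm.1 hcM (ε / M) (by positivity))
    (η / 2) (ENNReal.half_pos hη.ne')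
  filter_upwards [h2] with n hn
  calc P {ω | ε ≤ ‖(√(n : ℝ))⁻¹ * (∑ i ∈ Finset.range n, Z i ω) * c n ω - (0 : Ω → ℝ) ω‖}
      ≤ P ({ω | M ≤ |(√(n : ℝ))⁻¹ * ∑ i ∈ Finset.range n, Z i ω|} ∪
          {ω | ε / M ≤ ‖c n ω - (0 : Ω → ℝ) ω‖}) := by
        -- If the sum is below `M` and the factor below `ε / M`, the product is below `ε`.
        refine measure_mono fun ω hω => ?_
        simp only [Set.mem_union, Set.mem_ofPred_eq, Pi.zero_apply, sub_zero, norm_mul,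
          Real.norm_eq_abs, abs_mul] at hω ⊢
        by_contra hcon
        push Not at hcon
        have h3 := mul_lt_mul'' hcon.1 hcon.2 (by positivity) (by positivity)
        rw [mul_div_cancel₀ _ hM.ne'] at h3
        linarith
    _ ≤ _ := measure_union_le _ _
    _ ≤ η / 2 + η / 2 := add_le_add ((hcheb n M hM).trans hMη) hn
    _ = η := ENNReal.add_halves η

open Complex in
/-- The multivariate central limit theorem for centred random vectors. -/
theorem tendstoInDistribution_multivariateGaussian {Ω ι : Type*} [MeasurableSpace Ω]
    {P : Measure Ω} [IsProbabilityMeasure P] [Fintype ι] [DecidableEq ι] {V : ℕ → Ω → ι → ℝ}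
    (hL : ∀ k, MemLp (fun ω => V 0 ω k) 2 P) (hmean : ∀ k, ∫ ω, V 0 ω k ∂P = 0)
    (hindep : iIndepFun V P) (hident : ∀ i, IdentDistrib (V i) (V 0) P P)
    {S : Matrix ι ι ℝ} (hS : S.PosSemidef) (hcov : ∀ j k, S j k = ∫ ω, V 0 ω j * V 0 ω k ∂P) :
    TendstoInDistribution
      (fun (n : ℕ) ω => (WithLp.toLp 2 fun k =>
        (√(n : ℝ))⁻¹ * ∑ i ∈ Finset.range n, V i ω k : EuclideanSpace ℝ ι))
      atTop id (fun _ => P) (multivariateGaussian 0 S) := by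
  have hV : ∀ i k, AEMeasurable (fun ω => V i ω k) P := fun i k =>
    (measurable_pi_apply k).comp_aemeasurable (hident i).aemeasurable_fst
  have hm : ∀ n : ℕ, AEMeasurable (fun ω => (WithLp.toLp 2 fun k =>
        (√(n : ℝ))⁻¹ * ∑ i ∈ Finset.range n, V i ω k : EuclideanSpace ℝ ι)) P := by
    intro n
    refine (WithLp.measurable_toLp 2 _).comp_aemeasurable (aemeasurable_pi_lambda _ fun k => ?_)
    exact (Finset.aemeasurable_fun_sum _ fun i _ => hV i k).const_mul _
  refine ⟨hm, aemeasurable_id, ?_⟩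
  refine ProbabilityMeasure.tendsto_iff_tendsto_charFun.2 fun t => ?_
  simp only [ProbabilityMeasure.coe_mk, Measure.map_id]
  rw [charFun_multivariateGaussian hS]
  -- Cramér–Wold: the characteristic function of the vector sum at `t` is that of the scalar sum of
  -- the `W i` at `1`, so the scalar theorem applies.
  set W : ℕ → Ω → ℝ := fun i ω => ∑ k, V i ω k * t k with hW
  have hg : Measurable fun v : ι → ℝ => ∑ k, v k * t k := by fun_prop
  have hWL : MemLp (W 0) 2 P := memLp_finsetSum _ fun k _ => (hL k).mul_const _
  have hWm : ∫ ω, W 0 ω ∂P = 0 := by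
    simp only [hW]
    rw [integral_finsetSum _ fun k _ => ((hL k).integrable (by norm_num)).mul_const _]
    simp [integral_mul_const, hmean]
  have hWv : Var[W 0; P] = t ⬝ᵥ S.mulVec t := by
    rw [variance_of_integral_eq_zero hWL.1.aemeasurable hWm]
    have : ∀ ω, W 0 ω ^ 2 = ∑ j, ∑ k, t j * t k * (V 0 ω j * V 0 ω k) := by
      intro ω
      rw [hW, sq, Finset.sum_mul_sum]
      exact Finset.sum_congr rfl fun j _ => Finset.sum_congr rfl fun k _ => by ring
    simp only [this]
    have hI : ∀ j k, Integrable (fun ω => t j * t k * (V 0 ω j * V 0 ω k)) P := fun j k =>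
      ((hL j).integrable_mul (hL k)).const_mul _
    rw [integral_finsetSum _ fun j _ => integrable_finsetSum _ fun k _ => hI j k]
    simp only [dotProduct, Matrix.mulVec, Finset.mul_sum]
    refine Finset.sum_congr rfl fun j _ => ?_
    rw [integral_finsetSum _ fun k _ => hI j k]
    refine Finset.sum_congr rfl fun k _ => ?_
    rw [integral_const_mul, hcov]
    ring
  have hclt := tendstoInDistribution_inv_sqrt_mul_sum_sub (P := P) (X := W)
    (P' := gaussianReal 0 Var[W 0; P].toNNReal) (Y := id) HasLaw.id hWL
    (hindep.comp (fun _ => fun v : ι → ℝ => ∑ k, v k * t k) fun _ => hg)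
    (fun i => (hident i).comp hg)
  have h1 := ProbabilityMeasure.tendsto_iff_tendsto_charFun.1 hclt.tendsto 1
  simp only [ProbabilityMeasure.coe_mk, Measure.map_id, charFun_gaussianReal, hWm, mul_zero,
    sub_zero] at h1
  convert h1 using 2 with n
  · rw [charFun_apply, charFun_apply, integral_map (hm n) (by fun_prop),
      integral_map (by
        have := hclt.forall_aemeasurable n
        simpa only [hWm, mul_zero, sub_zero] using this) (by fun_prop)]
    congr 1
    ext ω
    congr 3
    simp only [PiLp.inner_apply, hW]
    simp only [RCLike.inner_apply, conj_trivial, Finset.mul_sum, one_mul]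
    rw [Finset.sum_comm]
    refine Finset.sum_congr rfl fun i _ => Finset.sum_congr rfl fun k _ => by ring
  · rw [← hWv, Real.coe_toNNReal _ (variance_nonneg _ _)]
    simp

theorem inner_toLp_eq_integral_mul {Ω : Type*} [MeasurableSpace Ω] {P : Measure Ω} {f g : Ω → ℝ}
    (hf : MemLp f 2 P) (hg : MemLp g 2 P) :
    inner ℝ (hf.toLp f) (hg.toLp g) = ∫ ω, f ω * g ω ∂P := by
  rw [L2.inner_def]
  refine integral_congr_ae ?_
  filter_upwards [hf.coeFn_toLp, hg.coeFn_toLp] with ω h1 h2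
  simp [h1, h2, mul_comm]

/-! ### Population side: regression, influence functions and their covariance -/

namespace IndividualR2

section Population

variable {Ω : Type*} [MeasurableSpace Ω] {P : Measure Ω} [IsProbabilityMeasure P]

/-- The projection on `span {1, Z}` is the linear regression on `Z`. -/
theorem proj_ae_eq {Z T : Ω → ℝ} (hZ : MemLp Z 2 P) (hT : MemLp T 2 P) (hV : 0 < Var[Z; P]) :
    proj hZ hT =ᵐ[P] fun ω =>
      (∫ ω', T ω' ∂P) + cov[T, Z; P] / Var[Z; P] * (Z ω - ∫ ω', Z ω' ∂P) := by
  set mT := ∫ ω', T ω' ∂P with hmT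
  set mZ := ∫ ω', Z ω' ∂P with hmZ
  set b := cov[T, Z; P] / Var[Z; P] with hb
  have h1 : MemLp (fun _ : Ω => (1 : ℝ)) 2 P := memLp_const 1
  have hF : MemLp (fun ω => mT + b * (Z ω - mZ)) 2 P :=
    (memLp_const mT).add ((hZ.sub (memLp_const mZ)).const_mul b)
  have iZ : Integrable Z P := hZ.integrable (by norm_num)
  have iT : Integrable T P := hT.integrable (by norm_num)
  have hZc : MemLp (fun ω => Z ω - mZ) 2 P := hZ.sub (memLp_const mZ)
  have hTc : MemLp (fun ω => T ω - mT) 2 P := hT.sub (memLp_const mT)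
  have iTZ : Integrable (fun ω => (T ω - mT) * (Z ω - mZ)) P := hTc.integrable_mul hZc
  have iZb : Integrable (fun ω => b * (Z ω - mZ)) P := (hZc.integrable (by norm_num)).const_mul b
  have iZZ : Integrable (fun ω => b * (Z ω - mZ) ^ 2) P := hZc.integrable_sq.const_mul b
  have hRes : MemLp (fun ω => T ω - (mT + b * (Z ω - mZ))) 2 P := hT.sub hF
  have hmem : hF.toLp _ ∈ spanOneAnd hZ := by
    refine Submodule.mem_span_pair.2 ⟨mT - b * mZ, b, ?_⟩
    rw [← MemLp.toLp_const_smul, ← MemLp.toLp_const_smul, ← MemLp.toLp_add]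
    refine MemLp.toLp_congr _ _ (Eventually.of_forall fun ω => ?_)
    simp only [Pi.add_apply, Pi.smul_apply, smul_eq_mul]
    ring
  have horth : hT.toLp T - hF.toLp _ ∈ (spanOneAnd hZ)ᗮ := by
    rw [← MemLp.toLp_sub, spanOneAnd, Submodule.mem_orthogonal]
    intro u hu
    obtain ⟨c, d, rfl⟩ := Submodule.mem_span_pair.1 hu
    rw [inner_add_left, real_inner_smul_left, real_inner_smul_left]
    have hi1 : inner ℝ (h1.toLp _) ((hT.sub hF).toLp _) = 0 := by
      rw [inner_toLp_eq_integral_mul]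
      simp only [Pi.sub_apply, one_mul]
      rw [integral_sub iT (hF.integrable (by norm_num)), integral_add (integrable_const _) iZb, integral_const_mul,
        integral_sub iZ (integrable_const _)]
      simp [hmT, hmZ]
    -- The normal equation: the slope `b` is the value for which this integral vanishes.
    -- Orthogonality to `Z` itself then follows from orthogonality to `1`.
    have hi2 : ∫ ω, (Z ω - mZ) * (T ω - (mT + b * (Z ω - mZ))) ∂P = 0 := by
      have e : ∀ ω, (Z ω - mZ) * (T ω - (mT + b * (Z ω - mZ)))
          = (T ω - mT) * (Z ω - mZ) - b * (Z ω - mZ) ^ 2 := fun ω => by ring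
      simp only [e]
      rw [integral_sub iTZ iZZ, integral_const_mul,
        ← variance_eq_integral hZ.1.aemeasurable, hb, div_mul_cancel₀ _ hV.ne', covariance,
        sub_self]
    have hi3 : inner ℝ (hZ.toLp Z) ((hT.sub hF).toLp _) = 0 := by
      rw [inner_toLp_eq_integral_mul] at hi1 ⊢
      simp only [Pi.sub_apply, one_mul] at hi1 ⊢
      have e : ∀ ω, Z ω * (T ω - (mT + b * (Z ω - mZ)))
          = (Z ω - mZ) * (T ω - (mT + b * (Z ω - mZ)))
            + mZ * (T ω - (mT + b * (Z ω - mZ))) := fun ω => by ring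
      have iZR : Integrable (fun ω => (Z ω - mZ) * (T ω - (mT + b * (Z ω - mZ)))) P :=
        hZc.integrable_mul hRes
      simp only [e]
      rw [integral_add iZR
        ((hRes.integrable (by norm_num)).const_mul _), hi2, integral_const_mul, hi1]
      simp
    rw [hi1, hi3]
    simp
  have := Submodule.eq_starProjection_of_mem_orthogonal hmem horth
  rw [proj, this]
  exact hF.coeFn_toLp

theorem residual_ae_eq {Z T : Ω → ℝ} (hZ : MemLp Z 2 P) (hT : MemLp T 2 P) (hV : 0 < Var[Z; P]) :
    residual hZ hT =ᵐ[P] fun ω =>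
      (T ω - ∫ ω', T ω' ∂P) - cov[T, Z; P] / Var[Z; P] * (Z ω - ∫ ω', Z ω' ∂P) := by
  filter_upwards [proj_ae_eq hZ hT hV] with ω h
  rw [residual, h]
  ring

/-- The regression line has variance (c / Var X)² Var X = c² / Var X, with c the covariance;
dividing by Var Y splits as a product of the two slopes. -/
theorem rSq_eq_tau_mul_theta {p : ℕ} {Y : Ω → ℝ} {X : Fin p → Ω → ℝ} (hY : MemLp Y 2 P)
    (hX : ∀ j, MemLp (X j) 2 P) (k : Fin p) (hV : 0 < Var[X k; P]) :
    rSq (hX k) hY = tau P Y X k * theta P Y X k := by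
  have hm : AEStronglyMeasurable (fun ω => cov[Y, X k; P] / Var[X k; P] *
      (X k ω - ∫ ω', X k ω' ∂P)) P := ((hX k).1.sub aestronglyMeasurable_const).const_mul _
  rw [rSq, variance_congr (proj_ae_eq (hX k) hY hV), variance_const_add hm, variance_const_mul,
    variance_sub_const (hX k).1, tau, theta]
  field_simp

variable {p : ℕ}

/-- The influence function of the estimator of the `k`-th individual coefficient. -/
noncomputable def influence {Y : Ω → ℝ} {X : Fin p → Ω → ℝ} (hY : MemLp Y 2 P)
    (hX : ∀ k, MemLp (X k) 2 P) (k : Fin p) (ω : Ω) : ℝ :=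
  theta P Y X k * (Var[X k; P])⁻¹ * ((X k ω - ∫ ω', X k ω' ∂P) * residual (hX k) hY ω) +
    tau P Y X k * (Var[Y; P])⁻¹ * ((Y ω - ∫ ω', Y ω' ∂P) * residual hY (hX k) ω)

theorem residual_aestronglyMeasurable {Z T : Ω → ℝ} (hZ : MemLp Z 2 P) (hT : MemLp T 2 P) :
    AEStronglyMeasurable (residual hZ hT) P :=
  hT.1.sub (Lp.aestronglyMeasurable _)

/-- This is how the moment assumptions enter: they say that the summands of the central limit
theorem have finite second moment. -/
theorem memLp_two_centered_mul_residual {Z T W : Ω → ℝ} (hZ : MemLp Z 2 P) (hT : MemLp T 2 P)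
    (hW : MemLp W 2 P)
    (h : Integrable (fun ω => (W ω - ∫ ω', W ω' ∂P) ^ 2 * (residual hZ hT ω) ^ 2) P) :
    MemLp (fun ω => (W ω - ∫ ω', W ω' ∂P) * residual hZ hT ω) 2 P := by
  refine (memLp_two_iff_integrable_sq
    ((hW.1.sub aestronglyMeasurable_const).mul (residual_aestronglyMeasurable hZ hT))).2 ?_
  simpa only [Pi.mul_apply, Pi.sub_apply, mul_pow] using h

/-- `C` is the Gram matrix of the 2p products of a centred regressor with its residual. Row `k` of
`H D` has at most two nonzero entries, which are the coefficients of `influence` in these products.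
-/
theorem asympCov_apply {Y : Ω → ℝ} {X : Fin p → Ω → ℝ} (hY : MemLp Y 2 P)
    (hX : ∀ k, MemLp (X k) 2 P)
    (hMomX : ∀ j, Integrable
      (fun ω => (X j ω - ∫ ω', X j ω' ∂P) ^ 2 * (residual (hX j) hY ω) ^ 2) P)
    (hMomY : ∀ j, Integrable
      (fun ω => (Y ω - ∫ ω', Y ω' ∂P) ^ 2 * (residual hY (hX j) ω) ^ 2) P) (j k : Fin p) :
    asympCov hY hX j k = ∫ ω, influence hY hX j ω * influence hY hX k ω ∂P := by
  have hA := fun i => memLp_two_centered_mul_residual (hX i) hY (hX i) (hMomX i)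
  have hB := fun i => memLp_two_centered_mul_residual hY (hX i) hY (hMomY i)
  have hL : asympCov hY hX j k =
      theta P Y X j * (Var[X j; P])⁻¹ * (theta P Y X k * (Var[X k; P])⁻¹) *
        matC hY hX (.inl j) (.inl k) +
      theta P Y X j * (Var[X j; P])⁻¹ * (tau P Y X k * (Var[Y; P])⁻¹) *
        matC hY hX (.inl j) (.inr k) +
      tau P Y X j * (Var[Y; P])⁻¹ * (theta P Y X k * (Var[X k; P])⁻¹) *
        matC hY hX (.inr j) (.inl k) +
      tau P Y X j * (Var[Y; P])⁻¹ * (tau P Y X k * (Var[Y; P])⁻¹) *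
        matC hY hX (.inr j) (.inr k) := by
    simp only [asympCov, matH, matD, Matrix.mul_apply, Fintype.sum_sum_type, Matrix.transpose_apply,
      Matrix.fromCols_apply_inl, Matrix.fromCols_apply_inr, Matrix.diagonal_apply, Sum.elim_inl,
      Sum.elim_inr, mul_ite, ite_mul,
      mul_zero, zero_mul, Finset.sum_ite_eq, Finset.sum_ite_eq', Finset.mem_univ, if_true]
    ring
  -- In the third term the factor with index `k` comes first, to match the transposed block of
  -- `matC`.
  have hR : ∀ ω, influence hY hX j ω * influence hY hX k ω =
      theta P Y X j * (Var[X j; P])⁻¹ * (theta P Y X k * (Var[X k; P])⁻¹) *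
        (((X j ω - ∫ ω', X j ω' ∂P) * residual (hX j) hY ω) *
          ((X k ω - ∫ ω', X k ω' ∂P) * residual (hX k) hY ω)) +
      theta P Y X j * (Var[X j; P])⁻¹ * (tau P Y X k * (Var[Y; P])⁻¹) *
        (((X j ω - ∫ ω', X j ω' ∂P) * residual (hX j) hY ω) *
          ((Y ω - ∫ ω', Y ω' ∂P) * residual hY (hX k) ω)) +
      tau P Y X j * (Var[Y; P])⁻¹ * (theta P Y X k * (Var[X k; P])⁻¹) *
        (((X k ω - ∫ ω', X k ω' ∂P) * residual (hX k) hY ω) *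
          ((Y ω - ∫ ω', Y ω' ∂P) * residual hY (hX j) ω)) +
      tau P Y X j * (Var[Y; P])⁻¹ * (tau P Y X k * (Var[Y; P])⁻¹) *
        (((Y ω - ∫ ω', Y ω' ∂P) * residual hY (hX j) ω) *
          ((Y ω - ∫ ω', Y ω' ∂P) * residual hY (hX k) ω)) := fun ω => by
    simp only [influence]
    ring
  simp only [hR]
  have i1 : Integrable (fun ω => theta P Y X j * (Var[X j; P])⁻¹ * (theta P Y X k * (Var[X k; P])⁻¹) *
      (((X j ω - ∫ ω', X j ω' ∂P) * residual (hX j) hY ω) *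
        ((X k ω - ∫ ω', X k ω' ∂P) * residual (hX k) hY ω))) P :=
    ((hA j).integrable_mul (hA k)).const_mul _
  have i2 : Integrable (fun ω => theta P Y X j * (Var[X j; P])⁻¹ * (tau P Y X k * (Var[Y; P])⁻¹) *
      (((X j ω - ∫ ω', X j ω' ∂P) * residual (hX j) hY ω) *
        ((Y ω - ∫ ω', Y ω' ∂P) * residual hY (hX k) ω))) P :=
    ((hA j).integrable_mul (hB k)).const_mul _
  have i3 : Integrable (fun ω => tau P Y X j * (Var[Y; P])⁻¹ * (theta P Y X k * (Var[X k; P])⁻¹) *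
      (((X k ω - ∫ ω', X k ω' ∂P) * residual (hX k) hY ω) *
        ((Y ω - ∫ ω', Y ω' ∂P) * residual hY (hX j) ω))) P :=
    ((hA k).integrable_mul (hB j)).const_mul _
  have i4 : Integrable (fun ω => tau P Y X j * (Var[Y; P])⁻¹ * (tau P Y X k * (Var[Y; P])⁻¹) *
      (((Y ω - ∫ ω', Y ω' ∂P) * residual hY (hX j) ω) *
        ((Y ω - ∫ ω', Y ω' ∂P) * residual hY (hX k) ω))) P :=
    ((hB j).integrable_mul (hB k)).const_mul _
  rw [hL, integral_add (by exact (i1.add i2).add i3) i4, integral_add (by exact i1.add i2) i3, integral_add i1 i2,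
    integral_const_mul, integral_const_mul, integral_const_mul, integral_const_mul]
  simp only [matC, Matrix.fromBlocks_apply₁₁, Matrix.fromBlocks_apply₁₂, Matrix.fromBlocks_apply₂₁,
    Matrix.fromBlocks_apply₂₂, Matrix.of_apply, Matrix.transpose_apply]
  congr 4 <;> congr 1 <;> ext ω <;> ring

theorem memLp_influence {Y : Ω → ℝ} {X : Fin p → Ω → ℝ} (hY : MemLp Y 2 P)
    (hX : ∀ k, MemLp (X k) 2 P)
    (hMomX : ∀ j, Integrable
      (fun ω => (X j ω - ∫ ω', X j ω' ∂P) ^ 2 * (residual (hX j) hY ω) ^ 2) P)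
    (hMomY : ∀ j, Integrable
      (fun ω => (Y ω - ∫ ω', Y ω' ∂P) ^ 2 * (residual hY (hX j) ω) ^ 2) P) (k : Fin p) :
    MemLp (influence hY hX k) 2 P :=
  ((memLp_two_centered_mul_residual (hX k) hY (hX k) (hMomX k)).const_mul _).add
    ((memLp_two_centered_mul_residual hY (hX k) hY (hMomY k)).const_mul _)

/-- For a Gram matrix, the quadratic form at `t` is the second moment of the combination of
influence functions with coefficients `t`. -/
theorem posSemidef_asympCov {Y : Ω → ℝ} {X : Fin p → Ω → ℝ} (hY : MemLp Y 2 P)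
    (hX : ∀ k, MemLp (X k) 2 P)
    (hMomX : ∀ j, Integrable
      (fun ω => (X j ω - ∫ ω', X j ω' ∂P) ^ 2 * (residual (hX j) hY ω) ^ 2) P)
    (hMomY : ∀ j, Integrable
      (fun ω => (Y ω - ∫ ω', Y ω' ∂P) ^ 2 * (residual hY (hX j) ω) ^ 2) P) :
    (asympCov hY hX).PosSemidef := by
  have hC := asympCov_apply hY hX hMomX hMomY
  have hL := memLp_influence hY hX hMomX hMomY
  refine Matrix.PosSemidef.of_dotProduct_mulVec_nonneg ?_ fun t => ?_
  · ext j k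
    simp only [Matrix.conjTranspose_apply, star_trivial, hC, mul_comm]
  · have : star t ⬝ᵥ (asympCov hY hX).mulVec t = ∫ ω, (∑ k, t k * influence hY hX k ω) ^ 2 ∂P := by
      have e : ∀ ω, (∑ k, t k * influence hY hX k ω) ^ 2 =
          ∑ j, ∑ k, t j * t k * (influence hY hX j ω * influence hY hX k ω) := by
        intro ω
        rw [sq, Finset.sum_mul_sum]
        exact Finset.sum_congr rfl fun j _ => Finset.sum_congr rfl fun k _ => by ring
      have hI : ∀ j k, Integrable
          (fun ω => t j * t k * (influence hY hX j ω * influence hY hX k ω)) P := fun j k =>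
        ((hL j).integrable_mul (hL k)).const_mul _
      simp only [e]
      rw [integral_finsetSum _ fun j _ => integrable_finsetSum _ fun k _ => hI j k]
      simp only [dotProduct, Matrix.mulVec, Finset.mul_sum, star_trivial]
      refine Finset.sum_congr rfl fun j _ => ?_
      rw [integral_finsetSum _ fun k _ => hI j k]
      refine Finset.sum_congr rfl fun k _ => ?_
      rw [integral_const_mul, hC]
      ring
    rw [this]
    exact integral_nonneg fun ω => sq_nonneg _

end Population

end IndividualR2

/-! ### Sample side: asymptotic linearity of the estimator -/

namespace IndividualR2

section Sample

/-- Empirical covariances are invariant under translation. Taking `a`, `b` to be the population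
means turns the estimator into a function of averages of i.i.d. variables. -/
theorem sampleCross_eq_nat_mul (n : ℕ) (y x : ℕ → ℝ) (a b : ℝ) :
    sampleCross n y x = n * ((∑ i ∈ Finset.range n, (y i - a) * (x i - b)) / n -
      (∑ i ∈ Finset.range n, (y i - a)) / n * ((∑ i ∈ Finset.range n, (x i - b)) / n)) := by
  rcases eq_or_ne n 0 with rfl | hn
  · simp [sampleCross]
  have hn' : (n : ℝ) ≠ 0 := Nat.cast_ne_zero.2 hn
  set u := sampleMean n y - a with hu
  set v := sampleMean n x - b with hv
  have hU : ∑ i ∈ Finset.range n, (y i - a) = n * u := by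
    rw [hu, sampleMean, Finset.sum_sub_distrib]
    simp only [Finset.sum_const, Finset.card_range, nsmul_eq_mul]
    field_simp
  have hV : ∑ i ∈ Finset.range n, (x i - b) = n * v := by
    rw [hv, sampleMean, Finset.sum_sub_distrib]
    simp only [Finset.sum_const, Finset.card_range, nsmul_eq_mul]
    field_simp
  have e : ∀ i, (y i - sampleMean n y) * (x i - sampleMean n x) =
      (y i - a) * (x i - b) - v * (y i - a) - u * (x i - b) + u * v := fun i => by
    rw [hu, hv]; ring
  simp only [sampleCross, e, Finset.sum_add_distrib, Finset.sum_sub_distrib (f := fun i => _ - _),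
    Finset.sum_sub_distrib (f := fun i => (y i - a) * (x i - b)), ← Finset.mul_sum, hU, hV,
    Finset.sum_const, Finset.card_range, nsmul_eq_mul]
  field_simp
  ring

/-- With a, b the empirical variances of x and y, use τ̂θ̂ - th = θ̂(τ̂ - t) + t(θ̂ - h), where τ̂ -
t = ((sxy - t sxx) - sx (sy - t sx)) / a and likewise for θ̂ - h. Replacing θ̂/a and 1/b by their
limits gives the main term; what remains is four normalised sums, each with a factor that will tend
to zero. -/
theorem rSqHat_linearization {s n sx sy sxx syy sxy t h VX VY : ℝ} (hs : s ^ 2 = n) (hn : n ≠ 0)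
    (ha : sxx - sx * sx ≠ 0) (hb : syy - sy * sy ≠ 0) (hVX : VX ≠ 0) (hVY : VY ≠ 0) :
    s * (n * (sxy - sy * sx) / (n * (sxx - sx * sx)) * (n * (sxy - sy * sx) /
        (n * (syy - sy * sy))) - t * h) -
      s⁻¹ * (h * VX⁻¹ * (n * (sxy - t * sxx)) + t * VY⁻¹ * (n * (sxy - h * syy))) =
    s⁻¹ * (n * (sxy - t * sxx)) *
        ((sxy - sy * sx) / ((syy - sy * sy) * (sxx - sx * sx)) - h * VX⁻¹) +
      s⁻¹ * (n * sx) *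
        (-((sy - t * sx) * ((sxy - sy * sx) / ((syy - sy * sy) * (sxx - sx * sx))))) +
      s⁻¹ * (n * (sxy - h * syy)) * (t * ((syy - sy * sy)⁻¹ - VY⁻¹)) +
      s⁻¹ * (n * sy) * (-(t * (sx - h * sy) * (syy - sy * sy)⁻¹)) := by
  subst hs
  have hs : s ≠ 0 := fun h => hn (by simp [h])
  -- Taking the empirical variances as variables makes the denominators atoms for `field_simp`.
  obtain ⟨a, rfl⟩ : ∃ a, sxx = a + sx * sx := ⟨sxx - sx * sx, by ring⟩
  obtain ⟨b, rfl⟩ : ∃ b, syy = b + sy * sy := ⟨syy - sy * sy, by ring⟩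
  simp only [add_sub_cancel_right] at ha hb ⊢
  field_simp
  ring

variable {Ω : Type*} [MeasurableSpace Ω] {P : Measure Ω}

theorem aemeasurable_sampleCross (n : ℕ) {y x : ℕ → Ω → ℝ} (hy : ∀ i, AEMeasurable (y i) P)
    (hx : ∀ i, AEMeasurable (x i) P) :
    AEMeasurable (fun ω => sampleCross n (fun i => y i ω) (fun i => x i ω)) P := by
  unfold sampleCross sampleMean
  fun_prop

theorem aemeasurable_rSqHat (n : ℕ) {y x : ℕ → Ω → ℝ} (hy : ∀ i, AEMeasurable (y i) P)
    (hx : ∀ i, AEMeasurable (x i) P) :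
    AEMeasurable (fun ω => rSqHat n (fun i => y i ω) (fun i => x i ω)) P :=
  ((aemeasurable_sampleCross n hy hx).div (aemeasurable_sampleCross n hx hx)).mul
    ((aemeasurable_sampleCross n hy hx).div (aemeasurable_sampleCross n hy hy))

/-- Asymptotic linearity of the empirical individual coefficient. -/
theorem tendstoInMeasure_rSqHat_sub [IsProbabilityMeasure P] {y x : ℕ → Ω → ℝ}
    (hy : MemLp (y 0) 2 P) (hx : MemLp (x 0) 2 P)
    (hindep : iIndepFun (fun i ω => (y i ω, x i ω)) P)
    (hident : ∀ i, IdentDistrib (fun ω => (y i ω, x i ω)) (fun ω => (y 0 ω, x 0 ω)) P P)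
    {mY mX VY VX c : ℝ} (hmY : ∫ ω, y 0 ω ∂P = mY) (hmX : ∫ ω, x 0 ω ∂P = mX)
    (hVY : ∫ ω, (y 0 ω - mY) * (y 0 ω - mY) ∂P = VY)
    (hVX : ∫ ω, (x 0 ω - mX) * (x 0 ω - mX) ∂P = VX)
    (hc : ∫ ω, (y 0 ω - mY) * (x 0 ω - mX) ∂P = c) (hVY0 : 0 < VY) (hVX0 : 0 < VX)
    (hQX : MemLp (fun ω => (x 0 ω - mX) * ((y 0 ω - mY) - c / VX * (x 0 ω - mX))) 2 P)
    (hQY : MemLp (fun ω => (y 0 ω - mY) * ((x 0 ω - mX) - c / VY * (y 0 ω - mY))) 2 P) :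
    TendstoInMeasure P (fun (n : ℕ) ω =>
      √(n : ℝ) * (rSqHat n (fun i => y i ω) (fun i => x i ω) - c / VX * (c / VY)) -
        (√(n : ℝ))⁻¹ * ∑ i ∈ Finset.range n,
          (c / VY * VX⁻¹ * ((x i ω - mX) * ((y i ω - mY) - c / VX * (x i ω - mX))) +
            c / VX * VY⁻¹ * ((y i ω - mY) * ((x i ω - mX) - c / VY * (y i ω - mY)))))
      atTop 0 := by
  have hym : ∀ i, AEMeasurable (y i) P := fun i =>
    measurable_fst.comp_aemeasurable (hident i).aemeasurable_fst
  have hxm : ∀ i, AEMeasurable (x i) P := fun i =>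
    measurable_snd.comp_aemeasurable (hident i).aemeasurable_fst
  have slln : ∀ f : ℝ × ℝ → ℝ, Measurable f → Integrable (fun ω => f (y 0 ω, x 0 ω)) P →
      ∀ᵐ ω ∂P, Tendsto (fun n : ℕ => (∑ i ∈ Finset.range n, f (y i ω, x i ω)) / n) atTop
        (𝓝 (∫ ω, f (y 0 ω, x 0 ω) ∂P)) := fun f hf hfi =>
    strong_law_ae_real (fun i ω => f (y i ω, x i ω)) hfi
      (fun i j hij => (hindep.indepFun hij).comp hf hf) (fun i => (hident i).comp hf)
  have slutsky : ∀ f : ℝ × ℝ → ℝ, Measurable f → MemLp (fun ω => f (y 0 ω, x 0 ω)) 2 P →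
      ∫ ω, f (y 0 ω, x 0 ω) ∂P = 0 → ∀ d : ℕ → Ω → ℝ, (∀ n, AEMeasurable (d n) P) →
      (∀ᵐ ω ∂P, Tendsto (fun n => d n ω) atTop (𝓝 0)) →
      TendstoInMeasure P
        (fun (n : ℕ) ω => (√(n : ℝ))⁻¹ * (∑ i ∈ Finset.range n, f (y i ω, x i ω)) * d n ω)
        atTop 0 := fun f hf hfi hf0 d hd hd0 =>
    tendstoInMeasure_inv_sqrt_mul_sum_mul (Z := fun i ω => f (y i ω, x i ω)) hfi hf0
      (hindep.comp (fun _ => f) fun _ => hf) (fun i => (hident i).comp hf) hd hd0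
  have hyc : MemLp (fun ω => y 0 ω - mY) 2 P := hy.sub (memLp_const mY)
  have hxc : MemLp (fun ω => x 0 ω - mX) 2 P := hx.sub (memLp_const mX)
  have iyy : Integrable (fun ω => (y 0 ω - mY) * (y 0 ω - mY)) P := hyc.integrable_mul hyc
  have ixx : Integrable (fun ω => (x 0 ω - mX) * (x 0 ω - mX)) P := hxc.integrable_mul hxc
  have iyx : Integrable (fun ω => (y 0 ω - mY) * (x 0 ω - mX)) P := hyc.integrable_mul hxc
  have hyc0 : ∫ ω, (y 0 ω - mY) ∂P = 0 := by
    rw [integral_sub (hy.integrable (by norm_num)) (integrable_const _), hmY]; simp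
  have hxc0 : ∫ ω, (x 0 ω - mX) ∂P = 0 := by
    rw [integral_sub (hx.integrable (by norm_num)) (integrable_const _), hmX]; simp
  have hQX0 : ∫ ω, (x 0 ω - mX) * ((y 0 ω - mY) - c / VX * (x 0 ω - mX)) ∂P = 0 := by
    have e : ∀ ω, (x 0 ω - mX) * ((y 0 ω - mY) - c / VX * (x 0 ω - mX)) =
        (y 0 ω - mY) * (x 0 ω - mX) - c / VX * ((x 0 ω - mX) * (x 0 ω - mX)) := fun ω => by ring
    simp only [e]
    rw [integral_sub iyx (ixx.const_mul _), integral_const_mul, hc, hVX,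
      div_mul_cancel₀ _ hVX0.ne', sub_self]
  have hQY0 : ∫ ω, (y 0 ω - mY) * ((x 0 ω - mX) - c / VY * (y 0 ω - mY)) ∂P = 0 := by
    have e : ∀ ω, (y 0 ω - mY) * ((x 0 ω - mX) - c / VY * (y 0 ω - mY)) =
        (y 0 ω - mY) * (x 0 ω - mX) - c / VY * ((y 0 ω - mY) * (y 0 ω - mY)) := fun ω => by ring
    simp only [e]
    rw [integral_sub iyx (iyy.const_mul _), integral_const_mul, hc, hVY,
      div_mul_cancel₀ _ hVY0.ne', sub_self]
  set sy : ℕ → Ω → ℝ := fun n ω => (∑ i ∈ Finset.range n, (y i ω - mY)) / n with hsy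
  set sx : ℕ → Ω → ℝ := fun n ω => (∑ i ∈ Finset.range n, (x i ω - mX)) / n with hsx
  set syy : ℕ → Ω → ℝ := fun n ω =>
    (∑ i ∈ Finset.range n, (y i ω - mY) * (y i ω - mY)) / n with hsyy
  set sxx : ℕ → Ω → ℝ := fun n ω =>
    (∑ i ∈ Finset.range n, (x i ω - mX) * (x i ω - mX)) / n with hsxx
  set sxy : ℕ → Ω → ℝ := fun n ω =>
    (∑ i ∈ Finset.range n, (y i ω - mY) * (x i ω - mX)) / n with hsxy
  have msy : ∀ n, AEMeasurable (sy n) P := fun n => by fun_prop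
  have msx : ∀ n, AEMeasurable (sx n) P := fun n => by fun_prop
  have msyy : ∀ n, AEMeasurable (syy n) P := fun n => by fun_prop
  have msxx : ∀ n, AEMeasurable (sxx n) P := fun n => by fun_prop
  have msxy : ∀ n, AEMeasurable (sxy n) P := fun n => by fun_prop
  have hlim : ∀ᵐ ω ∂P, Tendsto (fun n => sy n ω) atTop (𝓝 0) ∧
      Tendsto (fun n => sx n ω) atTop (𝓝 0) ∧ Tendsto (fun n => syy n ω) atTop (𝓝 VY) ∧
      Tendsto (fun n => sxx n ω) atTop (𝓝 VX) ∧ Tendsto (fun n => sxy n ω) atTop (𝓝 c) := by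
    have l1 := slln (fun q => q.1 - mY) (by fun_prop) (hyc.integrable (by norm_num))
    have l2 := slln (fun q => q.2 - mX) (by fun_prop) (hxc.integrable (by norm_num))
    have l3 := slln (fun q => (q.1 - mY) * (q.1 - mY)) (by fun_prop) iyy
    have l4 := slln (fun q => (q.2 - mX) * (q.2 - mX)) (by fun_prop) ixx
    have l5 := slln (fun q => (q.1 - mY) * (q.2 - mX)) (by fun_prop) iyx
    simp only [hyc0, hxc0, hVY, hVX, hc] at l1 l2 l3 l4 l5
    filter_upwards [l1, l2, l3, l4, l5] with ω h1 h2 h3 h4 h5 using ⟨h1, h2, h3, h4, h5⟩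
  have hlim' : ∀ᵐ ω ∂P, Tendsto (fun n => sxx n ω - sx n ω * sx n ω) atTop (𝓝 VX) ∧
      Tendsto (fun n => syy n ω - sy n ω * sy n ω) atTop (𝓝 VY) ∧
      Tendsto (fun n => (sxy n ω - sy n ω * sx n ω) /
        ((syy n ω - sy n ω * sy n ω) * (sxx n ω - sx n ω * sx n ω))) atTop
        (𝓝 (c / VY * VX⁻¹)) := by
    filter_upwards [hlim] with ω ⟨h1, h2, h3, h4, h5⟩
    have ha : Tendsto (fun n => sxx n ω - sx n ω * sx n ω) atTop (𝓝 VX) := by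
      simpa using h4.sub (h2.mul h2)
    have hb : Tendsto (fun n => syy n ω - sy n ω * sy n ω) atTop (𝓝 VY) := by
      simpa using h3.sub (h1.mul h1)
    refine ⟨ha, hb, ?_⟩
    have := (h5.sub (h1.mul h2)).div (hb.mul ha) (mul_pos hVY0 hVX0).ne'
    rw [mul_zero, sub_zero, div_mul_eq_div_div, div_eq_mul_inv (c / VY)] at this
    exact this
  -- The four factors of `rSqHat_linearization`. `c1` and `c3` compare a random coefficient with its
  -- limit; `c2` and `c4` carry an empirical mean of centred variables, coming from the centring at
  -- sample means.
  set c1 : ℕ → Ω → ℝ := fun n ω => (sxy n ω - sy n ω * sx n ω) /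
    ((syy n ω - sy n ω * sy n ω) * (sxx n ω - sx n ω * sx n ω)) - c / VY * VX⁻¹ with hc1
  set c2 : ℕ → Ω → ℝ := fun n ω => -((sy n ω - c / VX * sx n ω) * ((sxy n ω - sy n ω * sx n ω) /
    ((syy n ω - sy n ω * sy n ω) * (sxx n ω - sx n ω * sx n ω)))) with hc2
  set c3 : ℕ → Ω → ℝ := fun n ω =>
    c / VX * ((syy n ω - sy n ω * sy n ω)⁻¹ - VY⁻¹) with hc3
  set c4 : ℕ → Ω → ℝ := fun n ω =>
    -(c / VX * (sx n ω - c / VY * sy n ω) * (syy n ω - sy n ω * sy n ω)⁻¹) with hc4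
  have mc1 : ∀ n, AEMeasurable (c1 n) P := fun n => by fun_prop
  have mc2 : ∀ n, AEMeasurable (c2 n) P := fun n => by fun_prop
  have mc3 : ∀ n, AEMeasurable (c3 n) P := fun n => by fun_prop
  have mc4 : ∀ n, AEMeasurable (c4 n) P := fun n => by fun_prop
  have lc1 : ∀ᵐ ω ∂P, Tendsto (fun n => c1 n ω) atTop (𝓝 0) := by
    filter_upwards [hlim'] with ω ⟨_, _, h⟩
    simpa using h.sub_const (c / VY * VX⁻¹)
  have lc2 : ∀ᵐ ω ∂P, Tendsto (fun n => c2 n ω) atTop (𝓝 0) := by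
    filter_upwards [hlim', hlim] with ω ⟨_, _, h⟩ ⟨h1, h2, _⟩
    simpa using ((h1.sub (h2.const_mul (c / VX))).mul h).neg
  have lc3 : ∀ᵐ ω ∂P, Tendsto (fun n => c3 n ω) atTop (𝓝 0) := by
    filter_upwards [hlim'] with ω ⟨_, h, _⟩
    simpa using ((h.inv₀ hVY0.ne').sub_const VY⁻¹).const_mul (c / VX)
  have lc4 : ∀ᵐ ω ∂P, Tendsto (fun n => c4 n ω) atTop (𝓝 0) := by
    filter_upwards [hlim', hlim] with ω ⟨_, h, _⟩ ⟨h1, h2, _⟩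
    simpa using (((h2.sub (h1.const_mul (c / VY))).const_mul (c / VX)).mul (h.inv₀ hVY0.ne')).neg
  have t1 := slutsky (fun q => (q.2 - mX) * ((q.1 - mY) - c / VX * (q.2 - mX))) (by fun_prop)
    hQX hQX0 c1 mc1 lc1
  have t2 := slutsky (fun q => q.2 - mX) (by fun_prop) hxc hxc0 c2 mc2 lc2
  have t3 := slutsky (fun q => (q.1 - mY) * ((q.2 - mX) - c / VY * (q.1 - mY))) (by fun_prop)
    hQY hQY0 c3 mc3 lc3
  have t4 := slutsky (fun q => q.1 - mY) (by fun_prop) hyc hyc0 c4 mc4 lc4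
  set T : ℕ → Ω → ℝ := fun n ω =>
      √(n : ℝ) * (rSqHat n (fun i => y i ω) (fun i => x i ω) - c / VX * (c / VY)) -
        (√(n : ℝ))⁻¹ * ∑ i ∈ Finset.range n,
          (c / VY * VX⁻¹ * ((x i ω - mX) * ((y i ω - mY) - c / VX * (x i ω - mX))) +
            c / VX * VY⁻¹ * ((y i ω - mY) * ((x i ω - mX) - c / VY * (y i ω - mY)))) with hT
  have mT : ∀ n, AEMeasurable (T n) P := fun n => by
    have := aemeasurable_rSqHat n hym hxm
    fun_prop
  set g1 : ℕ → Ω → ℝ := fun n ω => (√(n : ℝ))⁻¹ * (∑ i ∈ Finset.range n,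
    (x i ω - mX) * ((y i ω - mY) - c / VX * (x i ω - mX))) * c1 n ω with hg1
  set g2 : ℕ → Ω → ℝ := fun n ω =>
    (√(n : ℝ))⁻¹ * (∑ i ∈ Finset.range n, (x i ω - mX)) * c2 n ω with hg2
  set g3 : ℕ → Ω → ℝ := fun n ω => (√(n : ℝ))⁻¹ * (∑ i ∈ Finset.range n,
    (y i ω - mY) * ((x i ω - mX) - c / VY * (y i ω - mY))) * c3 n ω with hg3
  set g4 : ℕ → Ω → ℝ := fun n ω =>
    (√(n : ℝ))⁻¹ * (∑ i ∈ Finset.range n, (y i ω - mY)) * c4 n ω with hg4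
  -- The algebraic identity needs nonzero denominators. Almost surely this holds for all large `n`,
  -- as the empirical variances have positive limits, so the difference is eventually exactly zero.
  have t5 : TendstoInMeasure P (fun n ω => T n ω - (g1 n ω + g2 n ω + g3 n ω + g4 n ω))
      atTop 0 := by
    refine tendstoInMeasure_of_tendsto_ae (fun n => ?_) ?_
    · exact AEMeasurable.aestronglyMeasurable (by fun_prop)
    filter_upwards [hlim'] with ω ⟨ha, hb, _⟩
    refine tendsto_const_nhds.congr' ?_
    filter_upwards [ha.eventually_ne hVX0.ne', hb.eventually_ne hVY0.ne',
      eventually_ne_atTop 0] with n hna hnb hn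
    have hn' : (n : ℝ) ≠ 0 := Nat.cast_ne_zero.2 hn
    have key := rSqHat_linearization (s := √(n : ℝ)) (sxy := sxy n ω) (t := c / VX) (h := c / VY)
      (Real.sq_sqrt (Nat.cast_nonneg n)) hn' hna hnb hVX0.ne' hVY0.ne'
    have e1 : (n : ℝ) * (sxy n ω - c / VX * sxx n ω) = ∑ i ∈ Finset.range n,
        (x i ω - mX) * ((y i ω - mY) - c / VX * (x i ω - mX)) := by
      have e : ∀ i, (x i ω - mX) * ((y i ω - mY) - c / VX * (x i ω - mX)) =
        (y i ω - mY) * (x i ω - mX) - c / VX * ((x i ω - mX) * (x i ω - mX)) := fun i => by ring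
      simp only [e, Finset.sum_sub_distrib, ← Finset.mul_sum, hsxy, hsxx]
      field_simp
    have e2 : (n : ℝ) * sx n ω = ∑ i ∈ Finset.range n, (x i ω - mX) := mul_div_cancel₀ _ hn'
    have e3 : (n : ℝ) * (sxy n ω - c / VY * syy n ω) = ∑ i ∈ Finset.range n,
        (y i ω - mY) * ((x i ω - mX) - c / VY * (y i ω - mY)) := by
      have e : ∀ i, (y i ω - mY) * ((x i ω - mX) - c / VY * (y i ω - mY)) =
        (y i ω - mY) * (x i ω - mX) - c / VY * ((y i ω - mY) * (y i ω - mY)) := fun i => by ring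
      simp only [e, Finset.sum_sub_distrib, ← Finset.mul_sum, hsxy, hsyy]
      field_simp
    have e4 : (n : ℝ) * sy n ω = ∑ i ∈ Finset.range n, (y i ω - mY) := mul_div_cancel₀ _ hn'
    rw [e1, e2, e3, e4, Finset.mul_sum, Finset.mul_sum, ← Finset.sum_add_distrib] at key
    simp only [hT, rSqHat, tauHat, thetaHat, sampleCross_eq_nat_mul n (fun i => x i ω) (fun i => x i ω) mX mX,
      sampleCross_eq_nat_mul n (fun i => y i ω) (fun i => x i ω) mY mX,
      sampleCross_eq_nat_mul n (fun i => y i ω) (fun i => y i ω) mY mY]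
    exact (sub_eq_zero.2 key).symm
  refine tendstoInMeasure_zero_of_norm_le_sum
    (g := ![g1, g2, g3, g4, fun n ω => T n ω - (g1 n ω + g2 n ω + g3 n ω + g4 n ω)]) ?_ ?_
  · intro k
    fin_cases k
    exacts [t1, t2, t3, t4, t5]
  · intro n ω
    simp only [Fin.sum_univ_five, Matrix.cons_val]
    set r := T n ω - (g1 n ω + g2 n ω + g3 n ω + g4 n ω) with hr
    have : T n ω = g1 n ω + g2 n ω + g3 n ω + g4 n ω + r := by rw [hr]; ring
    rw [this, Real.norm_eq_abs]
    refine (abs_add_le _ _).trans (add_le_add_left ?_ _)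
    refine (abs_add_le _ _).trans (add_le_add_left ?_ _)
    exact abs_add_three _ _ _

end Sample

end IndividualR2

/-! ### The limit theorem -/

theorem proposition6p2 {p : ℕ}
    {Ω : Type*} [MeasurableSpace Ω] {P : Measure Ω} [IsProbabilityMeasure P]
    -- the random vector `(Y, X_1, …, X_p)`, with square integrable entries
    {Y : Ω → ℝ} {X : Fin p → Ω → ℝ} (hY : MemLp Y 2 P) (hX : ∀ j, MemLp (X j) 2 P)
    (hVarY : 0 < Var[Y; P]) (hVarX : ∀ j, 0 < Var[X j; P])
    -- the moment assumptions
    (hMomX : ∀ j, Integrable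
      (fun ω => (X j ω - ∫ ω', X j ω' ∂P) ^ 2 * (IndividualR2.residual (hX j) hY ω) ^ 2) P)
    (hMomY : ∀ j, Integrable
      (fun ω => (Y ω - ∫ ω', Y ω' ∂P) ^ 2 * (IndividualR2.residual hY (hX j) ω) ^ 2) P)
    -- independent copies `(Ys i, Xs i 1, …, Xs i p)` of `(Y, X_1, …, X_p)`
    {Ω' : Type*} [MeasurableSpace Ω'] {P' : Measure Ω'} [IsProbabilityMeasure P']
    {Ys : ℕ → Ω' → ℝ} {Xs : ℕ → Fin p → Ω' → ℝ}
    (hIndep : iIndepFun (fun i ω => (Ys i ω, fun j => Xs i j ω)) P')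
    (hCopy : ∀ i, IdentDistrib (fun ω => (Ys i ω, fun j => Xs i j ω))
      (fun ω => (Y ω, fun j => X j ω)) P' P) :
    (IndividualR2.asympCov hY hX).PosSemidef ∧
    TendstoInDistribution
      (fun (n : ℕ) ω => (WithLp.toLp 2 fun k : Fin p =>
        √(n : ℝ) * (IndividualR2.rSqHat n (fun i => Ys i ω) (fun i => Xs i k ω)
          - IndividualR2.rSq (hX k) hY) : EuclideanSpace ℝ (Fin p)))
      atTop id (fun _ => P')
      (multivariateGaussian 0 (IndividualR2.asympCov hY hX)) := by
  have hS := IndividualR2.posSemidef_asympCov hY hX hMomX hMomY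
  refine ⟨hS, ?_⟩
  have hYs : ∀ i, AEMeasurable (Ys i) P' := fun i =>
    measurable_fst.comp_aemeasurable (hCopy i).aemeasurable_fst
  have hXs : ∀ i k, AEMeasurable (Xs i k) P' := fun i k =>
    ((measurable_pi_apply k).comp measurable_snd).comp_aemeasurable (hCopy i).aemeasurable_fst
  have hSelf : ∀ i, IdentDistrib (fun ω => (Ys i ω, fun j => Xs i j ω))
      (fun ω => (Ys 0 ω, fun j => Xs 0 j ω)) P' P' := fun i => (hCopy i).trans (hCopy 0).symm
  set mY := ∫ ω, Y ω ∂P with hmY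
  set mX : Fin p → ℝ := fun k => ∫ ω, X k ω ∂P with hmX
  set VY := Var[Y; P] with hVY
  set VX : Fin p → ℝ := fun k => Var[X k; P] with hVX
  set c : Fin p → ℝ := fun k => cov[Y, X k; P] with hc
  -- The residuals live on `Ω` and come from L² classes, while the copies live on `Ω'`. Explicit
  -- measurable functions of the vector, equal to the residual products almost everywhere, can be
  -- transferred through `hCopy`.
  set fX : Fin p → ℝ × (Fin p → ℝ) → ℝ := fun k q =>
    (q.2 k - mX k) * ((q.1 - mY) - c k / VX k * (q.2 k - mX k)) with hfX
  set fY : Fin p → ℝ × (Fin p → ℝ) → ℝ := fun k q =>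
    (q.1 - mY) * ((q.2 k - mX k) - c k / VY * (q.1 - mY)) with hfY
  set ψ : ℝ × (Fin p → ℝ) → Fin p → ℝ := fun q k =>
    c k / VY * (VX k)⁻¹ * fX k q + c k / VX k * VY⁻¹ * fY k q with hψ
  have mfX : ∀ k, Measurable (fX k) := fun k => by fun_prop
  have mfY : ∀ k, Measurable (fY k) := fun k => by fun_prop
  have mψ : Measurable ψ := measurable_pi_lambda _ fun k => by fun_prop
  have hrX : ∀ k, (fun ω => (X k ω - mX k) * IndividualR2.residual (hX k) hY ω) =ᵐ[P]
      fun ω => fX k (Y ω, fun j => X j ω) := fun k => by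
    filter_upwards [IndividualR2.residual_ae_eq (hX k) hY (hVarX k)] with ω h
    simp only [h, hfX]
    rfl
  have hrY : ∀ k, (fun ω => (Y ω - mY) * IndividualR2.residual hY (hX k) ω) =ᵐ[P]
      fun ω => fY k (Y ω, fun j => X j ω) := fun k => by
    filter_upwards [IndividualR2.residual_ae_eq hY (hX k) hVarY] with ω h
    simp only [h, hfY, covariance_comm (X k) Y]
    rfl
  have hinf : ∀ k, IndividualR2.influence hY hX k =ᵐ[P]
      fun ω => ψ (Y ω, fun j => X j ω) k := fun k => by
    filter_upwards [hrX k, hrY k] with ω h1 h2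
    simp only [hψ, ← h1, ← h2]
    rfl
  have lfX : ∀ k, MemLp (fun ω => fX k (Ys 0 ω, fun j => Xs 0 j ω)) 2 P' := fun k =>
    ((hCopy 0).comp (mfX k)).memLp_iff.2 ((memLp_congr_ae (hrX k)).1
      (IndividualR2.memLp_two_centered_mul_residual (hX k) hY (hX k) (hMomX k)))
  have lfY : ∀ k, MemLp (fun ω => fY k (Ys 0 ω, fun j => Xs 0 j ω)) 2 P' := fun k =>
    ((hCopy 0).comp (mfY k)).memLp_iff.2 ((memLp_congr_ae (hrY k)).1
      (IndividualR2.memLp_two_centered_mul_residual hY (hX k) hY (hMomY k)))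
  have hYc : MemLp (fun ω => Y ω - mY) 2 P := hY.sub (memLp_const mY)
  have hXc : ∀ k, MemLp (fun ω => X k ω - mX k) 2 P := fun k => (hX k).sub (memLp_const (mX k))
  have eVY : ∫ ω, (Y ω - mY) * (Y ω - mY) ∂P = VY := by
    rw [hVY, variance_eq_integral hY.1.aemeasurable]
    simp only [sq, hmY]
  have eVX : ∀ k, ∫ ω, (X k ω - mX k) * (X k ω - mX k) ∂P = VX k := fun k => by
    simp only [hVX]
    rw [variance_eq_integral (hX k).1.aemeasurable]
    simp only [sq, hmX]
  have ec : ∀ k, ∫ ω, (Y ω - mY) * (X k ω - mX k) ∂P = c k := fun k => rfl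
  have iYX : ∀ k, Integrable (fun ω => (Y ω - mY) * (X k ω - mX k)) P := fun k =>
    hYc.integrable_mul (hXc k)
  have iYY : Integrable (fun ω => (Y ω - mY) * (Y ω - mY)) P := hYc.integrable_mul hYc
  have iXX : ∀ k, Integrable (fun ω => (X k ω - mX k) * (X k ω - mX k)) P := fun k =>
    (hXc k).integrable_mul (hXc k)
  have zX : ∀ k, ∫ ω, fX k (Y ω, fun j => X j ω) ∂P = 0 := fun k => by
    have e : ∀ ω, fX k (Y ω, fun j => X j ω) =
        (Y ω - mY) * (X k ω - mX k) - c k / VX k * ((X k ω - mX k) * (X k ω - mX k)) :=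
      fun ω => by simp only [hfX]; ring
    simp only [e]
    rw [integral_sub (iYX k) ((iXX k).const_mul _), integral_const_mul, ec, eVX,
      div_mul_cancel₀ _ (hVarX k).ne', sub_self]
  have zY : ∀ k, ∫ ω, fY k (Y ω, fun j => X j ω) ∂P = 0 := fun k => by
    have e : ∀ ω, fY k (Y ω, fun j => X j ω) =
        (Y ω - mY) * (X k ω - mX k) - c k / VY * ((Y ω - mY) * (Y ω - mY)) :=
      fun ω => by simp only [hfY]; ring
    simp only [e]
    rw [integral_sub (iYX k) (iYY.const_mul _), integral_const_mul, ec, eVY,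
      div_mul_cancel₀ _ hVarY.ne', sub_self]
  have transfer : ∀ f : ℝ × (Fin p → ℝ) → ℝ, Measurable f →
      ∫ ω, f (Ys 0 ω, fun j => Xs 0 j ω) ∂P' = ∫ ω, f (Y ω, fun j => X j ω) ∂P := fun f hf =>
    ((hCopy 0).comp hf).integral_eq
  have hclt := tendstoInDistribution_multivariateGaussian
    (V := fun i ω => ψ (Ys i ω, fun j => Xs i j ω)) (P := P')
    (fun k => ((lfX k).const_mul _).add ((lfY k).const_mul _))
    (fun k => by
      simp only [hψ]
      rw [integral_add (((lfX k).integrable (by norm_num)).const_mul _)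
        (((lfY k).integrable (by norm_num)).const_mul _), integral_const_mul, integral_const_mul,
        transfer _ (mfX k), transfer _ (mfY k), zX, zY]
      simp)
    (hIndep.comp (fun _ => ψ) fun _ => mψ) (fun i => (hSelf i).comp mψ) hS
    (fun j k => by
      rw [IndividualR2.asympCov_apply hY hX hMomX hMomY,
        transfer (fun q => ψ q j * ψ q k) (by fun_prop)]
      refine integral_congr_ae ?_
      filter_upwards [hinf j, hinf k] with ω h1 h2
      rw [h1, h2])
  -- Slutsky: it remains to show that the estimator and the sum of influence functions differ by a
  -- term vanishing in measure, which is checked coordinate by coordinate.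
  refine tendstoInDistribution_of_tendstoInMeasure_sub _ _ hclt ?_ fun n => ?_
  · refine tendstoInMeasure_zero_of_norm_le_sum (κ := Fin p) (fun k =>
      IndividualR2.tendstoInMeasure_rSqHat_sub (P := P') (y := Ys) (x := fun i => Xs i k)
        (mY := mY) (mX := mX k) (VY := VY) (VX := VX k) (c := c k) ?_ ?_ ?_ ?_ ?_ ?_ ?_ ?_ ?_
        hVarY (hVarX k) (lfX k) (lfY k)) ?_
    · exact ((hCopy 0).comp measurable_fst).memLp_iff.2 hY
    · exact ((hCopy 0).comp ((measurable_pi_apply k).comp measurable_snd)).memLp_iff.2 (hX k)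
    · exact hIndep.comp (fun _ q => (q.1, q.2 k)) fun _ => by fun_prop
    · exact fun i => (hSelf i).comp (u := fun q => (q.1, q.2 k)) (by fun_prop)
    · exact transfer (fun q => q.1) (by fun_prop)
    · exact transfer (fun q => q.2 k) (by fun_prop)
    · exact (transfer (fun q => (q.1 - mY) * (q.1 - mY)) (by fun_prop)).trans eVY
    · exact (transfer (fun q => (q.2 k - mX k) * (q.2 k - mX k)) (by fun_prop)).trans (eVX k)
    · exact transfer (fun q => (q.1 - mY) * (q.2 k - mX k)) (by fun_prop)
    · intro n ω
      -- The Euclidean norm is at most the sum of the absolute values of the coordinates.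
      refine (EuclideanSpace.norm_eq _).le.trans ?_
      refine (Real.sqrt_le_left (Finset.sum_nonneg fun _ _ => abs_nonneg _)).2 ?_
      refine le_trans (le_of_eq ?_)
        (Finset.sum_sq_le_sq_sum_of_nonneg fun _ _ => abs_nonneg _)
      refine Finset.sum_congr rfl fun k _ => ?_
      rw [Real.norm_eq_abs]
      simp only [Pi.sub_apply, PiLp.sub_apply]
      rw [IndividualR2.rSq_eq_tau_mul_theta hY hX k (hVarX k)]
      rfl
  · refine (WithLp.measurable_toLp 2 _).comp_aemeasurable (aemeasurable_pi_lambda _ fun k => ?_)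
    exact ((IndividualR2.aemeasurable_rSqHat n hYs fun i => hXs i k).sub_const _).const_mul _
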